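/- Let $(\mu_n)_{n\in\mathbb N}$ and $\mu$ be finite signed Borel measures on $\mathbb R$, with distribution functions $F^{(\mu_n)}(x)=\mu_n((-\infty,x])$ and $F^{(\mu)}(x)=\mu((-\infty,x])$, and let $|\mu_n|=\mu_n^++\mu_n^-$ be the total variation measure given by the Hahn--Jordan decomposition. We say that: * $\mu_n$ converges to $\mu$ *loosely* if $\int_{\mathbb R} f\,d\mu_n\to\int_{\mathbb R} f\,d\mu$ for every continuous $f:\mathbb R\to\mathbb R$ vanishing at infinity; * $\mu_n$ converges to $\mu$ *basically* if every subsequence $(\mu_{n_k})_k$ has a further subsequence $(\mu_{n_{k_l}})_l$ and an at most countable set $S\subset\mathbb R$ such that $F^{(\mu_{n_{k_l}})}(x_1)-F^{(\mu_{n_{k_l}})}(x_2)\to F^{(\mu)}(x_1)-F^{(\mu)}(x_2)$ as $l\to\infty$ for all $x_1,x_2\in\mathbb R\setminus S$; * $\mu_n$ converges to $\mu$ *almost basically* if the same holds with $S$ only required to have Lebesgue measure zero. Then the following are equivalent: 1. $\mu_n$ converges to $\mu$ loosely; 2. $\mu_n$ converges to $\mu$ basically and $\sup_{n\in\mathbb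 N}|\mu_n|(\mathbb R)<\infty$; 3. $\mu_n$ converges to $\mu$ almost basically and $\sup_{n\in\mathbb N}|\mu_n|(\mathbb R)<\infty$. -/

import Mathlib

open MeasureTheory Filter Topology
open scoped ZeroAtInfty ENNReal

namespace SignedConv

/-- The distribution function `F^(μ)(x) = μ((-∞, x])` of a finite signed Borel measure on `ℝ`. -/
noncomputable def distFun (μ : SignedMeasure ℝ) (x : ℝ) : ℝ := μ (Set.Iic x)

/-- Loose convergence: convergence of the integrals of all continuous functions `ℝ → ℝ` that
vanish at infinity. -/
def ConvLoosely (μs : ℕ → SignedMeasure ℝ) (μ : SignedMeasure ℝ) : Prop :=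
  ∀ f : C₀(ℝ, ℝ), Tendsto (fun n => ∫ᵛ x, f x ∂<•(μs n)) atTop (𝓝 (∫ᵛ x, f x ∂<•μ))

/-- Basic convergence of functions: every subsequence has a further subsequence along which all
differences of values converge off an at most countable set. -/
def FunConvBasically (fs : ℕ → ℝ → ℝ) (f : ℝ → ℝ) : Prop :=
  ∀ φ : ℕ → ℕ, StrictMono φ → ∃ ψ : ℕ → ℕ, StrictMono ψ ∧ ∃ S : Set ℝ, S.Countable ∧
    ∀ x₁ ∉ S, ∀ x₂ ∉ S,
      Tendsto (fun l => fs (φ (ψ l)) x₁ - fs (φ (ψ l)) x₂) atTop (𝓝 (f x₁ - f x₂))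

/-- Almost basic convergence of functions: as basic convergence, but with an exceptional set of
Lebesgue measure zero. -/
def FunConvAlmostBasically (fs : ℕ → ℝ → ℝ) (f : ℝ → ℝ) : Prop :=
  ∀ φ : ℕ → ℕ, StrictMono φ → ∃ ψ : ℕ → ℕ, StrictMono ψ ∧ ∃ S : Set ℝ, volume S = 0 ∧
    ∀ x₁ ∉ S, ∀ x₂ ∉ S,
      Tendsto (fun l => fs (φ (ψ l)) x₁ - fs (φ (ψ l)) x₂) atTop (𝓝 (f x₁ - f x₂))

/-- Basic convergence of finite signed measures. -/
def ConvBasically (μs : ℕ → SignedMeasure ℝ) (μ : SignedMeasure ℝ) : Prop :=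
  FunConvBasically (fun n => distFun (μs n)) (distFun μ)

/-- Almost basic convergence of finite signed measures. -/
def ConvAlmostBasically (μs : ℕ → SignedMeasure ℝ) (μ : SignedMeasure ℝ) : Prop :=
  FunConvAlmostBasically (fun n => distFun (μs n)) (distFun μ)

/-- Uniform boundedness in variation: `sup_n |μ_n|(ℝ) < ∞`, where `|μ_n| = μ_n⁺ + μ_n⁻` is given
by the Hahn-Jordan decomposition. -/
def UnifBoundedVariation (μs : ℕ → SignedMeasure ℝ) : Prop :=
  (⨆ n, (μs n).totalVariation Set.univ) < ∞

end SignedConv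

namespace SignedConv

/-! Loose convergence is pointwise convergence of functionals on `C₀(ℝ, ℝ)`, so Banach–Steinhaus
bounds their norms. The norm of such a functional dominates the total variation
(`variation_univ_le_of_forall_integral_le`), which gives the uniform bound. Given that bound, Helly
selection (`exists_subseq_small_Ioc`) yields a subsequence whose variations are small near every
point off a countable set. Between two such points a trapezoid replaces the indicator at little
cost, so increments of the distribution functions converge. Conversely, the complement of a null set
is dense, so a function in `C₀(ℝ, ℝ)` is a uniform limit of step functions with nodes there
(`exists_step_approx`). Their integrals are finite combinations of convergent increments, and
bounded variation makes the error uniform in `n`. -/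

/-! ### Integrals against a signed measure and its variation -/

instance isFiniteMeasure_variation {X : Type*} [MeasurableSpace X] (μ : SignedMeasure X) :
    IsFiniteMeasure μ.variation := by
  rw [← SignedMeasure.totalVariation_eq_variation]
  infer_instance

theorem abs_integral_le {X : Type*} [MeasurableSpace X] (μ : SignedMeasure X) (f : X → ℝ) :
    |∫ᵛ x, f x ∂<•μ| ≤ ∫ x, |f x| ∂μ.variation := by
  have h := VectorMeasure.norm_integral_le_integral_norm (μ := μ) (f := f)
    (B := (ContinuousLinearMap.lsmul ℝ ℝ).flip)
  have hB : ‖(ContinuousLinearMap.lsmul ℝ ℝ (E := ℝ)).flip‖ ≤ 1 := by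
    rw [ContinuousLinearMap.opNorm_flip]
    exact ContinuousLinearMap.opNorm_lsmul_le
  have h0 : 0 ≤ ∫ x, ‖f x‖ ∂μ.variation := integral_nonneg fun _ => norm_nonneg _
  exact h.trans ((mul_le_mul_of_nonneg_right hB h0).trans_eq (one_mul _))

theorem integrable_zeroAtInfty (μ : SignedMeasure ℝ) (f : C₀(ℝ, ℝ)) :
    Integrable (fun x => f x) μ.variation :=
  (f.toBCF).integrable μ.variation

theorem integral_indicator_one {X : Type*} [MeasurableSpace X] (μ : SignedMeasure X) {s : Set X}
    (hs : MeasurableSet s) : ∫ᵛ x, s.indicator (fun _ => (1 : ℝ)) x ∂<•μ = μ s := by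
  rw [VectorMeasure.integral_indicator_const _ hs]
  simp

theorem apply_Ioc (μ : SignedMeasure ℝ) {a b : ℝ} (h : a ≤ b) :
    μ (Set.Ioc a b) = distFun μ b - distFun μ a := by
  have := μ.of_union (A := Set.Iic a) (B := Set.Ioc a b)
    (Set.disjoint_left.2 fun x hx hx' => not_lt.2 hx hx'.1) measurableSet_Iic measurableSet_Ioc
  rw [Set.Iic_union_Ioc_eq_Iic h] at this
  simp only [distFun, this, add_sub_cancel_left]

theorem abs_integral_sub_le {X : Type*} [MeasurableSpace X] (μ : SignedMeasure X) {f g : X → ℝ}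
    (hf : Integrable f μ.variation) (hg : Integrable g μ.variation) :
    |∫ᵛ x, f x ∂<•μ - ∫ᵛ x, g x ∂<•μ| ≤ ∫ x, |f x - g x| ∂μ.variation := by
  rw [← VectorMeasure.integral_fun_sub hf hg]
  exact abs_integral_le μ _

/-! ### Total variation as a dual norm -/

/-- The total mass of the variation is the integral of the sign function of a Hahn
decomposition. -/
theorem exists_apply_sub_apply_compl_eq_variation {X : Type*} [MeasurableSpace X]
    (μ : SignedMeasure X) :
    ∃ s, MeasurableSet s ∧ μ s - μ sᶜ = μ.variation.real Set.univ := by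
  obtain ⟨s, hs, hpos, hneg, hp, hn⟩ := μ.toJordanDecomposition_spec
  refine ⟨s, hs, ?_⟩
  rw [← SignedMeasure.totalVariation_eq_variation, SignedMeasure.totalVariation,
    measureReal_add_apply, hp, hn,
    SignedMeasure.toMeasureOfZeroLE_real_apply _ hpos hs MeasurableSet.univ,
    SignedMeasure.toMeasureOfLEZero_real_apply _ hneg hs.compl MeasurableSet.univ,
    Set.inter_univ, Set.inter_univ, sub_eq_add_neg]

/-- The variation of a signed measure is at most the norm of the functional it defines on the
continuous functions vanishing at infinity. -/
theorem variation_univ_le_of_forall_integral_le (μ : SignedMeasure ℝ) {C : ℝ} (hC : 0 ≤ C)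
    (h : ∀ f : C₀(ℝ, ℝ), |∫ᵛ x, f x ∂<•μ| ≤ C * ‖f‖) : μ.variation.real Set.univ ≤ C := by
  obtain ⟨s, hs, hsμ⟩ := exists_apply_sub_apply_compl_eq_variation μ
  refine le_of_forall_pos_le_add fun ε hε => ?_
  have hi : ∀ t : Set ℝ, MeasurableSet t →
      Integrable (t.indicator fun _ => (1 : ℝ)) μ.variation := fun t ht =>
    (integrable_const 1).indicator ht
  set σ : ℝ → ℝ := fun x => s.indicator (fun _ => 1) x - sᶜ.indicator (fun _ => 1) x with hσ
  have hσi : Integrable σ μ.variation := (hi s hs).sub (hi _ hs.compl)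
  have hσμ : ∫ᵛ x, σ x ∂<•μ = μ.variation.real Set.univ := by
    rw [hσ, VectorMeasure.integral_fun_sub (hi s hs) (hi _ hs.compl),
      integral_indicator_one μ hs, integral_indicator_one μ hs.compl, hsμ]
  have hσ1 : ∀ x, σ x = 1 ∨ σ x = -1 := fun x => by
    by_cases hx : x ∈ s <;> simp [hσ, hx]
  obtain ⟨g, hgs, hgε, hgc, hgi⟩ := hσi.exists_hasCompactSupport_integral_sub_le hε
  -- Clipping to `[-1, 1]` makes the norm at most `1` and, as `σ = ±1`, never increases the distance
  -- to `σ`.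
  let c : ℝ → ℝ := fun y => max (-1) (min 1 y)
  have hc : Continuous c := by fun_prop
  have hcs : HasCompactSupport (c ∘ g) := hgs.comp_left (by simp [c])
  let f : C₀(ℝ, ℝ) := ⟨⟨c ∘ g, hc.comp hgc⟩, hcs.is_zero_at_infty⟩
  have hf : ∀ x, f x = c (g x) := fun _ => rfl
  have hfn : ‖f‖ ≤ 1 := by
    rw [← ZeroAtInftyContinuousMap.norm_toBCF_eq_norm]
    refine (BoundedContinuousFunction.norm_le zero_le_one).2 fun x => ?_
    rw [Real.norm_eq_abs, abs_le]
    exact ⟨le_max_left _ _, max_le (by norm_num) (min_le_left _ _)⟩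
  have hfi := integrable_zeroAtInfty μ f
  have h1 : |∫ᵛ x, σ x ∂<•μ - ∫ᵛ x, f x ∂<•μ| ≤ ε := by
    refine (abs_integral_sub_le μ hσi hfi).trans (le_trans ?_ hgε)
    refine integral_mono (hσi.sub hfi).abs (hσi.sub hgi).norm fun x => ?_
    simp only [hf, c, Real.norm_eq_abs]
    rcases hσ1 x with hx | hx <;> rw [hx] <;>
      rcases max_cases (-1) (min 1 (g x)) with ⟨e, _⟩ | ⟨e, _⟩ <;> rw [e] <;>
      rcases min_cases 1 (g x) with ⟨e', _⟩ | ⟨e', _⟩ <;> (try rw [e']) <;>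
      rw [abs_le] <;> constructor <;>
      cases abs_cases (1 - g x) <;> cases abs_cases (-1 - g x) <;> linarith
  have h2 := h f
  have h3 : C * ‖f‖ ≤ C := mul_le_of_le_one_right hC hfn
  rw [hσμ] at h1
  linarith [(abs_le.1 h1).2, (abs_le.1 h2).2]

/-- Integration against a signed measure, as a functional on the continuous functions vanishing
at infinity. -/
noncomputable def integralCLM (μ : SignedMeasure ℝ) : C₀(ℝ, ℝ) →L[ℝ] ℝ :=
  LinearMap.mkContinuous
    { toFun := fun f => ∫ᵛ x, f x ∂<•μ
      map_add' := fun f g => VectorMeasure.integral_fun_add (integrable_zeroAtInfty μ f)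
        (integrable_zeroAtInfty μ g)
      map_smul' := fun c f => VectorMeasure.integral_fun_smul μ _ c f }
    (μ.variation.real Set.univ) fun f => by
      refine (abs_integral_le μ _).trans ?_
      calc ∫ x, |f x| ∂μ.variation ≤ ∫ _, ‖f‖ ∂μ.variation :=
            integral_mono (integrable_zeroAtInfty μ f).abs (integrable_const _) fun x => by
              rw [← ZeroAtInftyContinuousMap.norm_toBCF_eq_norm]
              exact f.toBCF.norm_coe_le_norm x
        _ = μ.variation.real Set.univ * ‖f‖ := by simp

theorem unifBoundedVariation_iff (μs : ℕ → SignedMeasure ℝ) :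
    UnifBoundedVariation μs ↔ ∃ C, ∀ n, (μs n).variation.real Set.univ ≤ C := by
  simp only [UnifBoundedVariation, SignedMeasure.totalVariation_eq_variation]
  constructor
  · intro h
    refine ⟨(⨆ n, (μs n).variation Set.univ).toReal, fun n => ?_⟩
    exact ENNReal.toReal_mono h.ne (le_iSup (fun n => (μs n).variation Set.univ) n)
  · rintro ⟨C, hC⟩
    refine lt_of_le_of_lt (iSup_le fun n => ?_) (ENNReal.ofReal_lt_top (r := C))
    rw [← ENNReal.ofReal_toReal (measure_ne_top (μs n).variation Set.univ)]
    exact ENNReal.ofReal_le_ofReal (hC n)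

theorem ConvLoosely.unifBoundedVariation {μs : ℕ → SignedMeasure ℝ} {μ : SignedMeasure ℝ}
    (h : ConvLoosely μs μ) : UnifBoundedVariation μs := by
  obtain ⟨C, hC⟩ := banach_steinhaus (g := fun n => integralCLM (μs n)) fun f => by
    obtain ⟨C, hC⟩ := (h f).norm.bddAbove_range
    exact ⟨C, fun n => hC ⟨n, rfl⟩⟩
  refine (unifBoundedVariation_iff μs).2 ⟨C, fun n => ?_⟩
  refine variation_univ_le_of_forall_integral_le _ ((norm_nonneg _).trans (hC n)) fun f => ?_
  exact ((integralCLM (μs n)).le_opNorm f).trans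
    (mul_le_mul_of_nonneg_right (hC n) (norm_nonneg _))

/-! ### From loose to basic convergence -/

/-- A form of Helly's selection theorem: along a subsequence, measures of bounded mass are
asymptotically small near every point outside a countable set. -/
theorem exists_subseq_small_Ioc (ν : ℕ → Measure ℝ) [∀ n, IsFiniteMeasure (ν n)] {C : ℝ}
    (hC : ∀ n, (ν n).real Set.univ ≤ C) :
    ∃ ψ : ℕ → ℕ, StrictMono ψ ∧ ∃ S : Set ℝ, S.Countable ∧ ∀ x ∉ S, ∀ ε > 0,
      ∃ a < x, ∃ b > x, ∀ᶠ l in atTop, (ν (ψ l)).real (Set.Ioc a b) < ε := by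
  have hmem : ∀ n, (fun q : ℚ => (ν n).real (Set.Iic (q : ℝ))) ∈
      Set.univ.pi fun _ : ℚ => Set.Icc 0 C := fun n q _ =>
    ⟨measureReal_nonneg, (measureReal_mono (Set.subset_univ _)).trans (hC n)⟩
  obtain ⟨g, hg, ψ, hψ, hlim⟩ :=
    (isCompact_univ_pi fun _ : ℚ => isCompact_Icc (a := (0 : ℝ)) (b := C)).tendsto_subseq hmem
  rw [tendsto_pi_nhds] at hlim
  have hmono : Monotone g := fun p q hpq => le_of_tendsto_of_tendsto' (hlim p) (hlim q) fun n =>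
    measureReal_mono (Set.Iic_subset_Iic.2 (by exact_mod_cast hpq))
  -- A monotone extension of the limit `g` from `ℚ` to `ℝ`; its discontinuities form the countable
  -- exceptional set.
  let G : ℝ → ℝ := fun x => sSup (g '' {q : ℚ | (q : ℝ) ≤ x})
  have hbdd : ∀ x, BddAbove (g '' {q : ℚ | (q : ℝ) ≤ x}) := fun x =>
    ⟨C, by rintro _ ⟨q, -, rfl⟩; exact (hg q trivial).2⟩
  have hne : ∀ x : ℝ, (g '' {q : ℚ | (q : ℝ) ≤ x}).Nonempty := fun x => by
    obtain ⟨q, hq⟩ := exists_rat_lt x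
    exact ⟨g q, q, hq.le, rfl⟩
  have hG : Monotone G := fun x y hxy => csSup_le_csSup (hbdd y) (hne x)
    (Set.image_mono fun q (hq : (q : ℝ) ≤ x) => hq.trans hxy)
  have hGq : ∀ q : ℚ, G q = g q := fun q => le_antisymm
    (csSup_le (hne q) (by rintro _ ⟨p, hp, rfl⟩; exact hmono (by exact_mod_cast hp)))
    (le_csSup (hbdd q) ⟨q, le_refl (q : ℝ), rfl⟩)
  refine ⟨ψ, hψ, {x | ¬ContinuousAt G x}, hG.countable_not_continuousAt, fun x hx ε hε => ?_⟩
  have hx' : ContinuousAt G x := not_not.1 hx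
  obtain ⟨δ, hδ, h⟩ := Metric.continuousAt_iff.1 hx' (ε / 2) (half_pos hε)
  obtain ⟨p, hp1, hp2⟩ := exists_rat_btwn (sub_lt_self x hδ)
  obtain ⟨r, hr1, hr2⟩ := exists_rat_btwn (lt_add_of_pos_right x hδ)
  refine ⟨p, hp2, r, hr1, ?_⟩
  have hpd := h (x := (p : ℝ)) (by rw [Real.dist_eq, abs_lt]; constructor <;> linarith)
  have hrd := h (x := (r : ℝ)) (by rw [Real.dist_eq, abs_lt]; constructor <;> linarith)
  rw [Real.dist_eq, abs_lt, hGq] at hpd hrd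
  have hlt : g r - g p < ε := by linarith [hpd.1, hrd.2]
  filter_upwards [((hlim r).sub (hlim p)).eventually_lt_const hlt] with l hl
  have hpr : (p : ℝ) ≤ r := (hp2.trans hr1).le
  rwa [← Set.Iic_sdiff_Iic, measureReal_sdiff (Set.Iic_subset_Iic.2 hpr) measurableSet_Iic]

/-- The indicator of `(x₁, x₂]` is approximated by a trapezoidal function, uniformly over all
signed measures of small variation near `x₁` and `x₂`. -/
theorem exists_integral_sub_distFun_le {a₁ x₁ b₁ a₂ x₂ b₂ : ℝ} (ha₁ : a₁ < x₁) (hb₁ : x₁ < b₁)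
    (ha₂ : a₂ < x₂) (hb₂ : x₂ < b₂) (hx : x₁ < x₂) :
    ∃ f : C₀(ℝ, ℝ), ∀ μ : SignedMeasure ℝ,
      |∫ᵛ x, f x ∂<•μ - (distFun μ x₂ - distFun μ x₁)| ≤
        μ.variation.real (Set.Ioc a₁ b₁) + μ.variation.real (Set.Ioc a₂ b₂) := by
  let t : ℝ → ℝ := fun x => max 0 (min 1 (min ((x - a₁) / (x₁ - a₁)) ((b₂ - x) / (b₂ - x₂))))
  have hpos₁ : 0 < x₁ - a₁ := sub_pos.2 ha₁
  have hpos₂ : 0 < b₂ - x₂ := sub_pos.2 hb₂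
  have ht : Continuous t := by fun_prop
  have ht0 : ∀ x, x ≤ a₁ ∨ b₂ ≤ x → t x = 0 := by
    rintro x (hx | hx)
    · refine max_eq_left ((min_le_right _ _).trans ((min_le_left _ _).trans ?_))
      exact div_nonpos_of_nonpos_of_nonneg (by linarith) hpos₁.le
    · refine max_eq_left ((min_le_right _ _).trans ((min_le_right _ _).trans ?_))
      exact div_nonpos_of_nonpos_of_nonneg (by linarith) hpos₂.le
  have ht1 : ∀ x, x₁ ≤ x → x ≤ x₂ → t x = 1 := by
    intro x h1 h2
    have e1 : 1 ≤ (x - a₁) / (x₁ - a₁) := (one_le_div hpos₁).2 (by linarith)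
    have e2 : 1 ≤ (b₂ - x) / (b₂ - x₂) := (one_le_div hpos₂).2 (by linarith)
    simp only [t, min_eq_left (le_min e1 e2), max_eq_right zero_le_one]
  have htn : ∀ x, 0 ≤ t x := fun x => le_max_left _ _
  have htl : ∀ x, t x ≤ 1 := fun x => max_le zero_le_one (min_le_left _ _)
  have hts : HasCompactSupport t := HasCompactSupport.intro (isCompact_Icc (a := a₁) (b := b₂))
    fun x hx => ht0 x (by
      by_contra! h
      exact hx ⟨h.1.le, h.2.le⟩)
  let f : C₀(ℝ, ℝ) := ⟨⟨t, ht⟩, hts.is_zero_at_infty⟩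
  refine ⟨f, fun μ => ?_⟩
  have hi : ∀ a b : ℝ, Integrable ((Set.Ioc a b).indicator fun _ => (1 : ℝ)) μ.variation :=
    fun a b => (integrable_const 1).indicator measurableSet_Ioc
  have hti : Integrable t μ.variation := integrable_zeroAtInfty μ f
  rw [← apply_Ioc μ hx.le, ← integral_indicator_one μ measurableSet_Ioc]
  refine (abs_integral_sub_le μ hti (hi _ _)).trans ?_
  have hind : ∀ a b : ℝ, ∫ x, (Set.Ioc a b).indicator (fun _ => (1 : ℝ)) x ∂μ.variation =
      μ.variation.real (Set.Ioc a b) := fun a b => by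
    rw [integral_indicator_const _ measurableSet_Ioc, smul_eq_mul, mul_one]
  rw [← hind a₁ b₁, ← hind a₂ b₂, ← integral_add (hi _ _) (hi _ _)]
  -- The difference is at most `1` in absolute value and vanishes off `(a₁, b₁] ∪ (a₂, b₂]`.
  refine integral_mono (hti.sub (hi _ _)).abs ((hi _ _).add (hi _ _)) fun x => ?_
  have hn : ∀ a b : ℝ, 0 ≤ (Set.Ioc a b).indicator (fun _ => (1 : ℝ)) x := fun a b =>
    Set.indicator_nonneg (fun _ _ => zero_le_one) x
  have hm : ∀ a b : ℝ, a < x → x ≤ b → (Set.Ioc a b).indicator (fun _ => (1 : ℝ)) x = 1 :=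
    fun a b h1 h2 => Set.indicator_of_mem (Set.mem_Ioc.2 ⟨h1, h2⟩) _
  have hz : ∀ a b : ℝ, x ≤ a ∨ b < x → (Set.Ioc a b).indicator (fun _ => (1 : ℝ)) x = 0 :=
    fun a b h => Set.indicator_of_notMem (fun hx => h.elim (not_le.2 hx.1) (not_lt.2 hx.2)) _
  have n1 := hn a₁ b₁
  have n2 := hn a₂ b₂
  have hte : |t x| ≤ 1 := by rw [abs_of_nonneg (htn x)]; exact htl x
  rcases le_or_gt x x₁ with h1 | h1
  · rw [hz x₁ x₂ (Or.inl h1), sub_zero]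
    rcases le_or_gt x a₁ with h2 | h2
    · rw [ht0 x (Or.inl h2), abs_zero]
      positivity
    · have := hm a₁ b₁ h2 (h1.trans hb₁.le)
      linarith
  rcases le_or_gt x x₂ with h3 | h3
  · rw [hm x₁ x₂ h1 h3, ht1 x h1.le h3, sub_self, abs_zero]
    positivity
  · rw [hz x₁ x₂ (Or.inr h3), sub_zero]
    rcases le_or_gt b₂ x with h2 | h2
    · rw [ht0 x (Or.inr h2), abs_zero]
      positivity
    · have := hm a₂ b₂ (ha₂.trans h3) h2.le
      linarith

theorem ConvLoosely.convBasically {μs : ℕ → SignedMeasure ℝ} {μ : SignedMeasure ℝ}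
    (h : ConvLoosely μs μ) : ConvBasically μs μ := by
  obtain ⟨C, hC⟩ := (unifBoundedVariation_iff μs).1 h.unifBoundedVariation
  intro φ hφ
  -- Adding `μ.variation` to each measure lets the same intervals control the limit as well.
  obtain ⟨ψ, hψ, S, hS, hsmall⟩ := exists_subseq_small_Ioc
    (fun n => (μs (φ n)).variation + μ.variation) (C := C + μ.variation.real Set.univ)
    fun n => by
      rw [measureReal_add_apply]
      exact add_le_add_left (hC _) _
  refine ⟨ψ, hψ, S, hS, ?_⟩
  have key : ∀ x₁ ∉ S, ∀ x₂ ∉ S, x₁ < x₂ →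
      Tendsto (fun l => distFun (μs (φ (ψ l))) x₂ - distFun (μs (φ (ψ l))) x₁) atTop
        (𝓝 (distFun μ x₂ - distFun μ x₁)) := by
    intro x₁ h₁ x₂ h₂ hx
    rw [Metric.tendsto_nhds]
    intro ε hε
    obtain ⟨a₁, ha₁, b₁, hb₁, hν₁⟩ := hsmall x₁ h₁ (ε / 3) (by positivity)
    obtain ⟨a₂, ha₂, b₂, hb₂, hν₂⟩ := hsmall x₂ h₂ (ε / 3) (by positivity)
    obtain ⟨f, hf⟩ := exists_integral_sub_distFun_le ha₁ hb₁ ha₂ hb₂ hx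
    have hlim := (h f).comp (hφ.comp hψ).tendsto_atTop
    filter_upwards [hν₁, hν₂, Metric.tendsto_nhds.1 hlim (ε / 3) (by positivity)]
      with l hl₁ hl₂ hl
    rw [measureReal_add_apply] at hl₁ hl₂
    have e1 := abs_le.1 (hf (μs (φ (ψ l))))
    have e2 := abs_le.1 (hf μ)
    simp only [Function.comp_apply, Real.dist_eq, abs_lt] at hl ⊢
    constructor <;> linarith
  intro x₁ h₁ x₂ h₂
  rcases lt_trichotomy x₁ x₂ with hx | rfl | hx
  · simpa using (key x₁ h₁ x₂ h₂ hx).neg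
  · simp
  · exact key x₂ h₂ x₁ h₁ hx

/-! ### From almost basic to loose convergence -/

/-- Continuous functions vanishing at infinity are uniform limits of step functions with nodes in
a given dense set. -/
theorem exists_step_approx {D : Set ℝ} (hD : Dense D) (f : C₀(ℝ, ℝ)) {ε : ℝ} (hε : 0 < ε) :
    ∃ (N : ℕ) (t : ℕ → ℝ), Monotone t ∧ (∀ i, t i ∈ D) ∧ ∀ x,
      |f x - ∑ i ∈ Finset.range N,
        f (t i) * (Set.Ioc (t i) (t (i + 1))).indicator (fun _ => (1 : ℝ)) x| ≤ ε := by
  obtain ⟨R, hR⟩ : ∃ R : ℝ, ∀ x, R < |x| → |f x| < ε := by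
    have h0 := Metric.tendsto_nhds.1 f.zero_at_infty' ε hε
    rw [← Metric.cobounded_eq_cocompact, ← comap_norm_atTop] at h0
    obtain ⟨s, hs, hsub⟩ := h0
    obtain ⟨R, hR⟩ := mem_atTop_sets.1 hs
    exact ⟨R, fun x hx => by simpa [Real.dist_eq] using hsub (hR _ hx.le : ‖x‖ ∈ s)⟩
  have huc : UniformContinuous f :=
    f.toContinuousMap.continuous.uniformContinuous_of_tendsto_cocompact f.zero_at_infty'
  obtain ⟨δ, hδ, hfδ⟩ := Metric.uniformContinuous_iff.1 huc ε hε
  -- One node per abutting interval of length `δ / 2`: nodes increase with gaps below `δ`, and the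
  -- shift `i - 1` puts `t 0` left of `-R`.
  have hex : ∀ i : ℕ, ∃ y ∈ D, -R + (i - 1) * (δ / 2) < y ∧ y < -R + i * (δ / 2) := fun i => by
    obtain ⟨y, hy, hy'⟩ := hD.exists_between
      (show -R + ((i : ℝ) - 1) * (δ / 2) < -R + i * (δ / 2) by linarith)
    exact ⟨y, hy, hy'⟩
  choose t htD htl htr using hex
  have hmono : Monotone t := monotone_nat_of_le_succ fun i => by
    have h1 := htr i
    have h2 := htl (i + 1)
    push_cast at h2
    linarith
  obtain ⟨N, hN⟩ := exists_nat_gt (2 * |R| / (δ / 2) + 1)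
  have hN' : 2 * |R| < (N - 1) * (δ / 2) := by
    rw [← div_lt_iff₀ (by positivity)]
    linarith
  refine ⟨N, t, hmono, htD, fun x => ?_⟩
  by_cases hx : x ∈ Set.Ioc (t 0) (t N)
  · have hU := hmono.biUnion_Ico_Ioc_map_succ 0 N
    rw [← hU] at hx
    simp only [Set.mem_iUnion, Set.mem_Ico, exists_prop] at hx
    obtain ⟨i, hi, hxi⟩ := hx
    have hxi' : x ∈ Set.Ioc (t i) (t (i + 1)) := hxi
    rw [Finset.sum_eq_single i, Set.indicator_of_mem hxi', mul_one]
    · have h1 := htl i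
      have h2 := htr (i + 1)
      push_cast at h2
      refine (hfδ (a := x) (b := t i) ?_).le
      rw [Real.dist_eq, abs_of_pos (sub_pos.2 hxi'.1)]
      linarith [hxi'.2]
    · intro j _ hj
      rw [Set.indicator_of_notMem, mul_zero]
      intro hxj
      exact Set.disjoint_left.1 (hmono.pairwise_disjoint_on_Ioc_succ hj) hxj hxi
    · intro h
      exact absurd (Finset.mem_range.2 hi.2) h
  · rw [Finset.sum_eq_zero, sub_zero]
    · refine (hR x ?_).le
      have h1 := htr 0
      have h2 := htl N
      rw [Set.mem_Ioc, not_and_or, not_lt, not_le] at hx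
      rcases hx with hx | hx
      · refine lt_of_lt_of_le ?_ (neg_le_abs x)
        simp only [CharP.cast_eq_zero, zero_mul] at h1
        linarith
      · refine lt_of_lt_of_le ?_ (le_abs_self x)
        linarith [le_abs_self R]
    · intro i hi
      rw [Set.indicator_of_notMem, mul_zero]
      intro hxi
      exact hx ⟨(hmono (Nat.zero_le i)).trans_lt hxi.1,
        hxi.2.trans (hmono (Nat.succ_le_of_lt (Finset.mem_range.1 hi)))⟩

/-- The error depends on `μ` only through its total variation, so one step function serves a whole
bounded family. -/
theorem abs_integral_sub_sum_le (μ : SignedMeasure ℝ) (f : C₀(ℝ, ℝ)) {ε : ℝ} {N : ℕ}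
    {t : ℕ → ℝ} (ht : Monotone t)
    (h : ∀ x, |f x - ∑ i ∈ Finset.range N,
      f (t i) * (Set.Ioc (t i) (t (i + 1))).indicator (fun _ => (1 : ℝ)) x| ≤ ε) :
    |∫ᵛ x, f x ∂<•μ - ∑ i ∈ Finset.range N, f (t i) * (distFun μ (t (i + 1)) - distFun μ (t i))| ≤
      ε * μ.variation.real Set.univ := by
  have hi : ∀ i ∈ Finset.range N, Integrable (fun x =>
      f (t i) * (Set.Ioc (t i) (t (i + 1))).indicator (fun _ => (1 : ℝ)) x) μ.variation :=
    fun i _ => ((integrable_const 1).indicator measurableSet_Ioc).const_mul _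
  have hint : ∫ᵛ x, ∑ i ∈ Finset.range N,
      f (t i) * (Set.Ioc (t i) (t (i + 1))).indicator (fun _ => (1 : ℝ)) x ∂<•μ =
      ∑ i ∈ Finset.range N, f (t i) * (distFun μ (t (i + 1)) - distFun μ (t i)) := by
    rw [VectorMeasure.integral_finsetSum _ hi]
    refine Finset.sum_congr rfl fun i _ => ?_
    rw [← apply_Ioc μ (ht (Nat.le_succ i)), ← integral_indicator_one μ measurableSet_Ioc]
    exact VectorMeasure.integral_fun_smul μ _ (f (t i)) _
  rw [← hint]
  have hs := integrable_finsetSum _ hi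
  have hf := integrable_zeroAtInfty μ f
  refine (abs_integral_sub_le μ hf hs).trans ?_
  refine (integral_mono (hf.sub hs).abs (integrable_const ε) h).trans_eq ?_
  simp [mul_comm]

theorem ConvAlmostBasically.convLoosely {μs : ℕ → SignedMeasure ℝ} {μ : SignedMeasure ℝ}
    (h : ConvAlmostBasically μs μ) (hb : UnifBoundedVariation μs) : ConvLoosely μs μ := by
  obtain ⟨C, hC⟩ := (unifBoundedVariation_iff μs).1 hb
  intro f
  refine tendsto_of_subseq_tendsto fun ns hns => ?_
  -- `ns` only tends to infinity; the hypothesis `h` needs a strictly increasing sequence.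
  obtain ⟨θ, hθ, hnsθ⟩ := strictMono_subseq_of_tendsto_atTop hns
  obtain ⟨ψ, hψ, S, hS, hconv⟩ := h _ hnsθ
  refine ⟨θ ∘ ψ, ?_⟩
  have hD : Dense Sᶜ := Measure.dense_of_ae (measure_eq_zero_iff_ae_notMem.1 hS)
  obtain ⟨K, hCK, hμK⟩ : ∃ K, C ≤ K ∧ μ.variation.real Set.univ ≤ K :=
    ⟨_, le_max_left _ _, le_max_right _ _⟩
  have hK0 : 0 ≤ K := measureReal_nonneg.trans hμK
  rw [Metric.tendsto_nhds]
  intro ε hε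
  -- `K + 1` rather than `K`, since `K` may be zero.
  have hη : 0 < ε / (3 * (K + 1)) := by positivity
  obtain ⟨N, t, ht, htD, happ⟩ := exists_step_approx hD f hη
  have hηK : ε / (3 * (K + 1)) * K < ε / 3 := by
    rw [div_mul_eq_mul_div, div_lt_div_iff₀ (by positivity) (by positivity)]
    nlinarith
  have hsum : Tendsto (fun l => ∑ i ∈ Finset.range N, f (t i) *
      (distFun (μs (ns (θ (ψ l)))) (t (i + 1)) - distFun (μs (ns (θ (ψ l)))) (t i))) atTop
      (𝓝 (∑ i ∈ Finset.range N, f (t i) * (distFun μ (t (i + 1)) - distFun μ (t i)))) :=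
    tendsto_finsetSum _ fun i _ => (hconv _ (htD (i + 1)) _ (htD i)).const_mul _
  filter_upwards [Metric.tendsto_nhds.1 hsum (ε / 3) (by positivity)] with l hl
  have e1 := abs_le.1 ((abs_integral_sub_sum_le (μs (ns (θ (ψ l)))) f ht happ).trans
    (mul_le_mul_of_nonneg_left ((hC _).trans hCK) hη.le))
  have e2 := abs_le.1 ((abs_integral_sub_sum_le μ f ht happ).trans
    (mul_le_mul_of_nonneg_left hμK hη.le))
  simp only [Function.comp_apply, Real.dist_eq, abs_lt] at hl ⊢
  constructor <;> linarith

theorem ConvBasically.convAlmostBasically {μs : ℕ → SignedMeasure ℝ} {μ : SignedMeasure ℝ}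
    (h : ConvBasically μs μ) : ConvAlmostBasically μs μ := fun φ hφ =>
  let ⟨ψ, hψ, S, hS, hconv⟩ := h φ hφ
  ⟨ψ, hψ, S, hS.measure_zero volume, hconv⟩

end SignedConv

theorem corollary3p18 (μs : ℕ → SignedMeasure ℝ) (μ : SignedMeasure ℝ) :
    (SignedConv.ConvLoosely μs μ ↔
      SignedConv.ConvBasically μs μ ∧ SignedConv.UnifBoundedVariation μs) ∧
    (SignedConv.ConvLoosely μs μ ↔
      SignedConv.ConvAlmostBasically μs μ ∧ SignedConv.UnifBoundedVariation μs) := by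
  exact ⟨⟨fun h => ⟨h.convBasically, h.unifBoundedVariation⟩,
    fun h => h.1.convAlmostBasically.convLoosely h.2⟩,
   ⟨fun h => ⟨h.convBasically.convAlmostBasically, h.unifBoundedVariation⟩,
    fun h => h.1.convLoosely h.2⟩⟩
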